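/- Let $n,m\ge 0$ and consider a port-Hamiltonian descriptor system $E\dot x=(J-R)x+Bu$, $y=B^Hx$, with $E,J,R\in\mathbb C^{n,n}$, $B\in\mathbb C^{n,m}$, $E=E^H\ge 0$, $R=R^H\ge 0$ and $J=-J^H$. Let $\mathcal S_\infty(E)$ be any matrix whose columns form a basis of the right nullspace of $E$. Then there exist matrices $F_S=-F_S^H$ and $F_H=F_H^H$ in $\mathbb C^{m,m}$ such that the pencil $\lambda E-\bigl(J+BF_SB^H-(R+BF_HB^H)\bigr)$ is regular and of index at most one and $R+BF_HB^H\ge 0$, if and only if $$\operatorname{rank}\begin{bmatrix}E & (J-R)\,\mathcal S_\infty(E) & B\end{bmatrix}=n.$$ Here a square pencil $\lambda E-A$ is regular if $\det(\lambda_0E-A)\ne 0$ for some $\lambda_0\in\mathbb C$. The index of a regular pencil is the size of the largest block $\lambda N_\sigma-I_\sigma$ in its Kronecker (Weierstrass) canonical form, where $N_\sigma$ is the nilpotent $\sigma\times\sigma$ Jordan block; it is $0$ if $E$ is invertible. -/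

import Mathlib

open scoped Matrix ComplexOrder

/-- The data of a port-Hamiltonian descriptor system
`E x' = (J - R) x + B u`, `y = Bᴴ x` with quadratic Hamiltonian `½ xᴴ E x`:
`E = Eᴴ ≥ 0`, `R = Rᴴ ≥ 0` and `J = -Jᴴ` (there is no condition on `B`). -/
structure IsPHDAE {n : ℕ} (E J R : Matrix (Fin n) (Fin n) ℂ) : Prop where
  E_nonneg : E.PosSemidef
  R_nonneg : R.PosSemidef
  J_skew : J = -Jᴴ

/-- The square pencil `z E - A` is regular: `det (z E - A) ≠ 0` for some `z`. -/
def IsRegularPencil {n : ℕ} (E A : Matrix (Fin n) (Fin n) ℂ) : Prop :=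
  ∃ z : ℂ, (z • E - A).det ≠ 0

/-- The `s × s` nilpotent matrix with ones on the first superdiagonal and zeros elsewhere,
so that the block at infinity of size `s` of a pencil is `z * nilpotentBlock s - 1`. -/
def nilpotentBlock (s : ℕ) : Matrix (Fin s) (Fin s) ℂ :=
  Matrix.of fun i j => if (j : ℕ) = (i : ℕ) + 1 then 1 else 0

/-- The canonical form of a regular pencil `z E - A`. For nonsingular `S`, `T` (and up to a
renumbering `e` of the rows and columns),
`S (z E - A) T = diag (z 1 - A₁, z N_{σ 1} - 1, …, z N_{σ r} - 1)`,
where `A₁` carries the finite eigenvalues and the `N_{σ j}` are nilpotent Jordan blocks of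
sizes `σ j ≥ 1`. (The finite part `A₁` is not brought to Jordan form: this does not affect
the blocks at infinity.) -/
def HasInfiniteBlocks {n : ℕ} (E A : Matrix (Fin n) (Fin n) ℂ) {r : ℕ} (σ : Fin r → ℕ) : Prop :=
  (∀ j, 1 ≤ σ j) ∧
  ∃ (p : ℕ) (A₁ : Matrix (Fin p) (Fin p) ℂ) (e : Fin n ≃ Fin p ⊕ (Σ j : Fin r, Fin (σ j)))
    (S T : Matrix (Fin n) (Fin n) ℂ),
    IsUnit S ∧ IsUnit T ∧
    S * E * T = (Matrix.fromBlocks 1 0 0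
      (Matrix.blockDiagonal' fun j => nilpotentBlock (σ j))).submatrix e e ∧
    S * A * T = (Matrix.fromBlocks A₁ 0 0 1).submatrix e e

/-- The regular pencil `z E - A` has index `ν`: `ν` is the size of the largest block at
infinity in its canonical form, and `ν = 0` if there is no such block (`E` invertible). -/
def HasIndex {n : ℕ} (E A : Matrix (Fin n) (Fin n) ℂ) (ν : ℕ) : Prop :=
  ∃ (r : ℕ) (σ : Fin r → ℕ), HasInfiniteBlocks E A σ ∧ ν = Finset.univ.sup σ

/-- `FS`, `FH` solve the problem of regularization and index reduction by the proportional
output feedback `u = (FS - FH) y + v`. -/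
structure SolvesIndexReduction {n m : ℕ} (E J R : Matrix (Fin n) (Fin n) ℂ)
    (B : Matrix (Fin n) (Fin m) ℂ) (FS FH : Matrix (Fin m) (Fin m) ℂ) : Prop where
  FS_skew : FS = -FSᴴ
  FH_hermitian : FH = FHᴴ
  regular : IsRegularPencil E (J + B * FS * Bᴴ - (R + B * FH * Bᴴ))
  index_le_one : ∃ ν ≤ 1, HasIndex E (J + B * FS * Bᴴ - (R + B * FH * Bᴴ)) ν
  dissipation_nonneg : (R + B * FH * Bᴴ).PosSemidef

/-- The columns of `S` form a basis of the right nullspace of `M`. -/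
def IsNullspaceBasisMatrix {l n k : ℕ} (M : Matrix (Fin l) (Fin n) ℂ)
    (S : Matrix (Fin n) (Fin k) ℂ) : Prop :=
  LinearIndependent ℂ S.col ∧ Submodule.span ℂ (Set.range S.col) = LinearMap.ker M.mulVecLin

open Matrix

/-! The rank condition says that no `y ≠ 0` satisfies `y E = 0`, `y (J - R) S = 0` and `y B = 0`.
Necessity: feedback changes `J - R` by a term starting with `B`, which such a `y` kills. So `y`
annihilates `E` and the closed-loop matrix on `ker E`, which blocks at infinity of size at most one
forbid (`HasInfiniteBlocks.eq_zero_of_vecMul`). Sufficiency: `FS = 0`, `FH = 1` always works. By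
`exists_hasInfiniteBlocks_of_isHermitian` it is enough that `J - R - B Bᴴ` compresses to a
nonsingular map on `ker E`. If the compression kills `x`, the real part of its quadratic form at `x`
gives `R x = 0` and `Bᴴ x = 0`, and skewness of `J` makes `xᴴ` a vector `y` as above. -/

/-- A matrix has full row rank if and only if its left nullspace is trivial. -/
lemma rank_eq_iff_vecMul_eq_zero {n : ℕ} {κ : Type*} [Fintype κ] (M : Matrix (Fin n) κ ℂ) :
    M.rank = n ↔ ∀ y, y ᵥ* M = 0 → y = 0 := by
  have h1 : (∀ y, y ᵥ* M = 0 → y = 0) ↔ LinearIndependent ℂ M.row := by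
    rw [← Matrix.vecMul_injective_iff]
    exact (injective_iff_map_eq_zero M.vecMulLinear).symm
  rw [h1, linearIndependent_iff_card_eq_finrank_span, Matrix.rank_eq_finrank_span_row,
    Fintype.card_fin, eq_comm]
  rfl

lemma rank_fromCols_eq_iff {n : ℕ} {κ₁ κ₂ κ₃ : Type*} [Fintype κ₁] [Fintype κ₂] [Fintype κ₃]
    (M₁ : Matrix (Fin n) κ₁ ℂ) (M₂ : Matrix (Fin n) κ₂ ℂ) (M₃ : Matrix (Fin n) κ₃ ℂ) :
    (fromCols (fromCols M₁ M₂) M₃).rank = n ↔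
      ∀ y, y ᵥ* M₁ = 0 → y ᵥ* M₂ = 0 → y ᵥ* M₃ = 0 → y = 0 := by
  rw [rank_eq_iff_vecMul_eq_zero]
  have h (y : Fin n → ℂ) : y ᵥ* fromCols (fromCols M₁ M₂) M₃ = 0 ↔
      y ᵥ* M₁ = 0 ∧ y ᵥ* M₂ = 0 ∧ y ᵥ* M₃ = 0 := by
    simp only [vecMul_fromCols, funext_iff, Sum.forall, Sum.elim_inl, Sum.elim_inr,
      Pi.zero_apply, and_assoc]
  simp only [h, and_imp]

lemma IsNullspaceBasisMatrix.mul_eq_zero {l n k : ℕ} {M : Matrix (Fin l) (Fin n) ℂ}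
    {S : Matrix (Fin n) (Fin k) ℂ} (hS : IsNullspaceBasisMatrix M S) : M * S = 0 := by
  ext i j
  have h : S.col j ∈ LinearMap.ker M.mulVecLin := hS.2 ▸ Submodule.subset_span ⟨j, rfl⟩
  exact congrFun (LinearMap.mem_ker.1 h) i

lemma IsNullspaceBasisMatrix.exists_mulVec_eq {l n k : ℕ} {M : Matrix (Fin l) (Fin n) ℂ}
    {S : Matrix (Fin n) (Fin k) ℂ} (hS : IsNullspaceBasisMatrix M S) {x : Fin n → ℂ}
    (hx : M *ᵥ x = 0) : ∃ c, S *ᵥ c = x := by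
  have h : x ∈ LinearMap.range S.mulVecLin := by
    rw [Matrix.range_mulVecLin, hS.2]
    exact LinearMap.mem_ker.2 hx
  exact h

/-- The blocks of size one at infinity vanish. -/
lemma blockDiagonal_nilpotentBlock_eq_zero {r : ℕ} {σ : Fin r → ℕ} (hσ : ∀ j, σ j ≤ 1) :
    blockDiagonal' (fun j => nilpotentBlock (σ j)) = 0 := by
  suffices h : (fun j => nilpotentBlock (σ j)) = 0 by rw [h, blockDiagonal'_zero]
  funext j
  ext a b
  have := hσ j
  have hb : (b : ℕ) ≠ (a : ℕ) + 1 := by omega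
  simp [nilpotentBlock, hb]

/-- Up to nonzero factors, the determinant of the pencil is the characteristic polynomial of `A₁`,
so any non-eigenvalue of `A₁` serves. -/
lemma HasInfiniteBlocks.isRegularPencil {n r : ℕ} {E A : Matrix (Fin n) (Fin n) ℂ}
    {σ : Fin r → ℕ} (h : HasInfiniteBlocks E A σ) (hσ : ∀ j, σ j ≤ 1) : IsRegularPencil E A := by
  obtain ⟨-, p, A₁, e, S, T, -, -, hE, hA⟩ := h
  obtain ⟨z, hz⟩ : ∃ z, A₁.charpoly.eval z ≠ 0 := by
    by_contra! hc
    exact A₁.charpoly_monic.ne_zero (Polynomial.funext fun z => by simpa using hc z)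
  refine ⟨z, fun h0 => ?_⟩
  have hST : S * (z • E - A) * T =
      (fromBlocks (scalar (Fin p) z - A₁) 0 0 (-1)).submatrix e e := by
    rw [Matrix.mul_sub, Matrix.sub_mul, Matrix.mul_smul, Matrix.smul_mul, hE, hA,
      blockDiagonal_nilpotentBlock_eq_zero hσ]
    have h : z • fromBlocks 1 0 0 0 - fromBlocks A₁ 0 0 1 =
        fromBlocks (scalar (Fin p) z - A₁) 0 0
          (-1 : Matrix (Σ j : Fin r, Fin (σ j)) (Σ j : Fin r, Fin (σ j)) ℂ) := by
      rw [fromBlocks_smul, sub_eq_add_neg, fromBlocks_neg, fromBlocks_add]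
      simp [sub_eq_add_neg, smul_one_eq_diagonal]
    rw [← h]
    rfl
  have hdet := congrArg Matrix.det hST
  rw [det_mul, det_mul, h0, mul_zero, zero_mul, det_submatrix_equiv_self,
    det_fromBlocks_zero₁₂, ← eval_charpoly] at hdet
  have h1 : (-1 : Matrix (Σ j : Fin r, Fin (σ j)) (Σ j : Fin r, Fin (σ j)) ℂ).det ≠ 0 := by
    rw [det_neg, det_one, mul_one]
    exact pow_ne_zero _ (by norm_num)
  exact mul_ne_zero hz h1 hdet.symm

/-- If all blocks at infinity have size one, then no nonzero row vector annihilates both `E` and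
`A` times the nullspace of `E`. -/
lemma HasInfiniteBlocks.eq_zero_of_vecMul {n r : ℕ} {E A : Matrix (Fin n) (Fin n) ℂ}
    {σ : Fin r → ℕ} (h : HasInfiniteBlocks E A σ) (hσ : ∀ j, σ j ≤ 1) {y : Fin n → ℂ}
    (hyE : y ᵥ* E = 0) (hyA : ∀ x, E *ᵥ x = 0 → y ⬝ᵥ A *ᵥ x = 0) : y = 0 := by
  obtain ⟨-, p, A₁, e, S, T, hS, hT, hE, hA⟩ := h
  rw [blockDiagonal_nilpotentBlock_eq_zero hσ] at hE
  obtain ⟨q, rfl⟩ : ∃ q, q ᵥ* S = y :=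
    ⟨y ᵥ* S⁻¹, by rw [vecMul_vecMul, nonsing_inv_mul _ ((isUnit_iff_isUnit_det S).1 hS),
      vecMul_one]⟩
  have hq : q ᵥ* (S * E * T) = 0 := by
    rw [← vecMul_vecMul, ← vecMul_vecMul, hyE, zero_vecMul]
  -- The finite coordinates of `q` are read off `q (S E T) = 0`; the others come from testing `A` on
  -- the columns of `T` that lie in `ker E`.
  have hq0 : q = 0 := by
    funext i
    obtain ⟨i, rfl⟩ := e.symm.surjective i
    rcases i with i | i
    · have h1 := congrFun hq (e.symm (Sum.inl i))
      rw [hE] at h1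
      simpa [vecMul, dotProduct, ← e.symm.sum_comp, Fintype.sum_sum_type,
        Matrix.one_apply] using h1
    · have h0 : E *ᵥ (T *ᵥ Pi.single (e.symm (Sum.inr i)) 1) = 0 := by
        apply mulVec_injective_of_isUnit hS
        rw [mulVec_mulVec, mulVec_mulVec, hE, mulVec_single_one, mulVec_zero]
        funext a
        rcases ha : e a with b | b <;> simp [ha]
      have h1 := hyA _ h0
      rw [← dotProduct_mulVec, mulVec_mulVec, mulVec_mulVec, hA, mulVec_single_one] at h1
      simpa [dotProduct, ← e.symm.sum_comp, Fintype.sum_sum_type, Matrix.one_apply] using h1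
  rw [hq0, zero_vecMul]

/-- A Hermitian `E` and an `A` whose compression to the nullspace of `E` is nonsingular form a
pencil all of whose blocks at infinity have size one. -/
lemma exists_hasInfiniteBlocks_of_isHermitian {n : ℕ} {E A : Matrix (Fin n) (Fin n) ℂ}
    (hE : E.IsHermitian)
    (hA : ∀ x, E *ᵥ x = 0 → (∀ w, E *ᵥ w = 0 → star w ⬝ᵥ A *ᵥ x = 0) → x = 0) :
    ∃ r, HasInfiniteBlocks E A (fun _ : Fin r => 1) := by
  obtain ⟨U, d, hU, hU', hd⟩ : ∃ (U : Matrix (Fin n) (Fin n) ℂ) (d : Fin n → ℂ),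
      Uᴴ * U = 1 ∧ U * Uᴴ = 1 ∧ Uᴴ * E * U = diagonal d := by
    refine ⟨hE.eigenvectorUnitary, RCLike.ofReal ∘ hE.eigenvalues,
      Unitary.coe_star_mul_self hE.eigenvectorUnitary,
      Unitary.coe_mul_star_self hE.eigenvectorUnitary, ?_⟩
    rw [← hE.conjStarAlgAut_star_eigenvectorUnitary, Unitary.conjStarAlgAut_apply]
    simp [star_eq_conjTranspose]
  let p := Fintype.card {i // d i ≠ 0}
  let r := Fintype.card {i // ¬ d i ≠ 0}
  let e : Fin n ≃ Fin p ⊕ (Σ _ : Fin r, Fin 1) :=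
    (Equiv.sumCompl fun i => d i ≠ 0).symm.trans
      (Equiv.sumCongr (Fintype.equivFin _)
        ((Fintype.equivFin _).trans (Equiv.sigmaUnique (Fin r) fun _ => Fin 1).symm))
  have hl (i) : d (e.symm (Sum.inl i)) ≠ 0 := by
    simpa [e] using ((Fintype.equivFin {i // d i ≠ 0}).symm i).2
  have hr (i) : d (e.symm (Sum.inr i)) = 0 := by
    simpa [e] using ((Fintype.equivFin {i // ¬ d i ≠ 0}).symm i.1).2
  clear_value e
  have hEU : E * U = U * diagonal d := by
    rw [← hd, ← Matrix.mul_assoc, ← Matrix.mul_assoc, hU', Matrix.one_mul]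
  obtain ⟨A₁₁, A₁₂, A₂₁, A₂₂, hM⟩ : ∃ A₁₁ A₁₂ A₂₁ A₂₂,
      Uᴴ * A * U = (fromBlocks A₁₁ A₁₂ A₂₁ A₂₂).submatrix e e :=
    ⟨_, _, _, _, by
      rw [fromBlocks_toBlocks ((Uᴴ * A * U).submatrix e.symm e.symm)]
      simp⟩
  have hD : diagonal d =
      (fromBlocks (diagonal fun i => d (e.symm (Sum.inl i))) 0 0 0).submatrix e e := by
    rw [← Equiv.symm_symm e, ← Matrix.submatrix_id_id (diagonal d)]
    ext i j
    obtain ⟨i, rfl⟩ := e.symm.surjective i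
    obtain ⟨j, rfl⟩ := e.symm.surjective j
    rcases i with i | i <;> rcases j with j | j <;> simp [diagonal_apply, hr]
  -- In the eigenbasis of `E`, `ker E` consists of the vectors supported on the second block, so
  -- `A₂₂` is the compression in `hA`.
  have hA₂₂ : IsUnit A₂₂ := by
    rw [← mulVec_injective_iff_isUnit]
    suffices h : ∀ v, A₂₂.mulVecLin v = 0 → v = 0 from
      (injective_iff_map_eq_zero A₂₂.mulVecLin).2 h
    intro v hv
    replace hv : A₂₂ *ᵥ v = 0 := hv
    have hx := hA (U *ᵥ (Sum.elim 0 v ∘ e)) ?_ ?_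
    · have h1 : (Sum.elim 0 v ∘ e : Fin n → ℂ) = 0 := by
        rw [← one_mulVec (Sum.elim 0 v ∘ e), ← hU, ← mulVec_mulVec, hx, mulVec_zero]
      funext i
      simpa using congrFun h1 (e.symm (Sum.inr i))
    · rw [mulVec_mulVec, hEU, ← mulVec_mulVec]
      suffices h : diagonal d *ᵥ (Sum.elim 0 v ∘ e) = 0 by rw [h, mulVec_zero]
      funext i
      obtain ⟨i, rfl⟩ := e.symm.surjective i
      rcases i with i | i <;> simp [mulVec_diagonal, hr]
    · intro w hw
      have hw' : diagonal d *ᵥ (Uᴴ *ᵥ w) = 0 := by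
        rw [← hd, mulVec_mulVec, Matrix.mul_assoc, hU', Matrix.mul_one, ← mulVec_mulVec, hw,
          mulVec_zero]
      have h2 : star w ⬝ᵥ A *ᵥ (U *ᵥ (Sum.elim 0 v ∘ e)) =
          star (Uᴴ *ᵥ w) ⬝ᵥ (Uᴴ * A * U) *ᵥ (Sum.elim 0 v ∘ e) := by
        rw [star_mulVec, conjTranspose_conjTranspose, ← dotProduct_mulVec, mulVec_mulVec,
          mulVec_mulVec, ← Matrix.mul_assoc, ← Matrix.mul_assoc, hU', Matrix.one_mul]
      rw [h2, hM, submatrix_mulVec_equiv, Function.comp_assoc, Equiv.self_comp_symm,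
        Function.comp_id, fromBlocks_mulVec]
      simp only [Sum.elim_comp_inl, Sum.elim_comp_inr, hv, mulVec_zero, add_zero, zero_add]
      rw [dotProduct, ← e.symm.sum_comp]
      refine Finset.sum_eq_zero fun i _ => ?_
      rcases i with i | i
      · have h3 := congrFun hw' (e.symm (Sum.inl i))
        rw [mulVec_diagonal, Pi.zero_apply, mul_eq_zero, or_iff_right (hl i)] at h3
        simp [h3]
      · simp
  have hA₂₂' := (isUnit_iff_isUnit_det A₂₂).1 hA₂₂
  set Λ : Matrix (Fin p) (Fin p) ℂ := diagonal fun i => d (e.symm (Sum.inl i)) with hΛ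
  have hΛu : IsUnit Λ.det := by
    rw [hΛ, det_diagonal, isUnit_iff_ne_zero]
    exact Finset.prod_ne_zero_iff.2 fun i _ => hl i
  -- Block elimination with pivot `A₂₂`: `L` clears `A₁₂` and normalizes `Λ` and `A₂₂`, `N` clears
  -- `A₂₁`, and a scaled Schur complement remains as the finite part.
  let L := fromBlocks Λ⁻¹ (-(Λ⁻¹ * A₁₂ * A₂₂⁻¹)) 0 A₂₂⁻¹
  let N := fromBlocks (1 : Matrix (Fin p) (Fin p) ℂ) 0 (-(A₂₂⁻¹ * A₂₁))
    (1 : Matrix (Σ _ : Fin r, Fin 1) (Σ _ : Fin r, Fin 1) ℂ)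
  have hUu : IsUnit U := IsUnit.of_mul_eq_one _ hU'
  have hUu' : IsUnit Uᴴ := IsUnit.of_mul_eq_one _ hU
  have hL : IsUnit (L.submatrix e e) := by
    rw [isUnit_iff_isUnit_det, det_submatrix_equiv_self, det_fromBlocks_zero₂₁]
    exact (isUnit_nonsing_inv_det _ hΛu).mul (isUnit_nonsing_inv_det _ hA₂₂')
  have hN : IsUnit (N.submatrix e e) := by
    rw [isUnit_iff_isUnit_det, det_submatrix_equiv_self, det_fromBlocks_zero₁₂]
    simp
  have key (X : Matrix (Fin n) (Fin n) ℂ) :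
      L.submatrix e e * Uᴴ * X * (U * N.submatrix e e) =
        L.submatrix e e * (Uᴴ * X * U) * N.submatrix e e := by
    simp only [Matrix.mul_assoc]
  refine ⟨r, fun _ => le_rfl, p, Λ⁻¹ * (A₁₁ - A₁₂ * A₂₂⁻¹ * A₂₁), e, L.submatrix e e * Uᴴ,
    U * N.submatrix e e, hL.mul hUu', hUu.mul hN, ?_, ?_⟩
  · rw [key, hd, hD, blockDiagonal_nilpotentBlock_eq_zero fun _ => le_rfl,
      submatrix_mul_equiv, submatrix_mul_equiv]
    simp [L, N, fromBlocks_multiply, nonsing_inv_mul _ hΛu]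
  · rw [key, hM, submatrix_mul_equiv, submatrix_mul_equiv]
    simp [L, N, fromBlocks_multiply, nonsing_inv_mul _ hA₂₂', Matrix.mul_assoc, Matrix.mul_add,
      sub_eq_add_neg]

theorem mainTheorem2 {n m k : ℕ} (E J R : Matrix (Fin n) (Fin n) ℂ)
    (B : Matrix (Fin n) (Fin m) ℂ) (hsys : IsPHDAE E J R)
    (S : Matrix (Fin n) (Fin k) ℂ) (hS : IsNullspaceBasisMatrix E S) :
    (∃ FS FH : Matrix (Fin m) (Fin m) ℂ, SolvesIndexReduction E J R B FS FH) ↔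
      (Matrix.fromCols (Matrix.fromCols E ((J - R) * S)) B).rank = n := by
  rw [rank_fromCols_eq_iff]
  constructor
  · rintro ⟨FS, FH, h⟩ y hyE hyS hyB
    obtain ⟨ν, hν, r, σ, hblocks, rfl⟩ := h.index_le_one
    have hσ (j) : σ j ≤ 1 := (Finset.le_sup (Finset.mem_univ j)).trans hν
    refine hblocks.eq_zero_of_vecMul hσ hyE fun x hx => ?_
    obtain ⟨c, rfl⟩ := hS.exists_mulVec_eq hx
    have hA : J + B * FS * Bᴴ - (R + B * FH * Bᴴ) = (J - R) + B * ((FS - FH) * Bᴴ) := by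
      rw [Matrix.sub_mul, Matrix.mul_sub, Matrix.mul_assoc, Matrix.mul_assoc]
      abel
    rw [hA, add_mulVec, dotProduct_add, mulVec_mulVec, dotProduct_mulVec, hyS, zero_dotProduct,
      dotProduct_mulVec, ← vecMul_vecMul, hyB, zero_vecMul, zero_dotProduct, add_zero]
  · intro hrank
    have hBB : (B * Bᴴ).PosSemidef := posSemidef_self_mul_conjTranspose B
    have hA : J + B * (0 : Matrix (Fin m) (Fin m) ℂ) * Bᴴ -
        (R + B * (1 : Matrix (Fin m) (Fin m) ℂ) * Bᴴ) = J - R - B * Bᴴ := by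
      rw [Matrix.mul_zero, Matrix.zero_mul, add_zero, Matrix.mul_one, sub_add_eq_sub_sub]
    have hJ : Jᴴ = -J := by exact neg_eq_iff_eq_neg.1 hsys.J_skew.symm
    obtain ⟨r, hblocks⟩ := exists_hasInfiniteBlocks_of_isHermitian hsys.E_nonneg.isHermitian
        (A := J - R - B * Bᴴ) (by
      intro x hx hAx
      have hadj (w : Fin n → ℂ) : star x ⬝ᵥ J *ᵥ w = -star (star w ⬝ᵥ J *ᵥ x) := by
        rw [← star_dotProduct_star, star_star, star_mulVec, hJ, vecMul_neg, neg_dotProduct,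
          neg_neg, dotProduct_mulVec]
      have h0 := hAx x hx
      rw [sub_mulVec, sub_mulVec, dotProduct_sub, dotProduct_sub, sub_sub, sub_eq_zero] at h0
      have hR0 := hsys.R_nonneg.dotProduct_mulVec_nonneg x
      have hB0 := hBB.dotProduct_mulVec_nonneg x
      have hre : (star x ⬝ᵥ J *ᵥ x).re = 0 := by
        have := congrArg Complex.re (hadj x)
        simp only [Complex.neg_re, Complex.star_def, Complex.conj_re] at this
        linarith
      have hsum : star x ⬝ᵥ R *ᵥ x + star x ⬝ᵥ (B * Bᴴ) *ᵥ x = 0 := by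
        have h := Complex.nonneg_iff.1 (add_nonneg hR0 hB0)
        exact Complex.ext (by rw [← h0, hre, Complex.zero_re]) h.2.symm
      obtain ⟨hR1, hB1⟩ := (add_eq_zero_iff_of_nonneg hR0 hB0).1 hsum
      have hRx := (hsys.R_nonneg.dotProduct_mulVec_zero_iff x).1 hR1
      have hBBx := (hBB.dotProduct_mulVec_zero_iff x).1 hB1
      have hBx : star x ᵥ* B = 0 := by
        rw [← mulVec_mulVec, dotProduct_mulVec, ← conjTranspose_conjTranspose B, ← star_mulVec,
          conjTranspose_conjTranspose, dotProduct_star_self_eq_zero] at hB1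
        rw [← conjTranspose_conjTranspose B, ← star_mulVec, hB1, star_zero]
      -- With `R x` and `B Bᴴ x` gone, `hAx` concerns `J` alone, and `hadj` turns this condition on
      -- the column `J x` into one on the row `xᴴ J`.
      have hJx (w : Fin n → ℂ) (hw : E *ᵥ w = 0) : star x ⬝ᵥ J *ᵥ w = 0 := by
        have := hAx w hw
        rw [sub_mulVec, sub_mulVec, hRx, hBBx, sub_zero, sub_zero] at this
        rw [hadj, this, star_zero, neg_zero]
      have hxR : star x ᵥ* R = 0 := by
        rw [← hsys.R_nonneg.isHermitian.eq, ← star_mulVec, hRx, star_zero]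
      refine star_eq_zero.1 (hrank (star x) ?_ ?_ hBx)
      · rw [← hsys.E_nonneg.isHermitian.eq, ← star_mulVec, hx, star_zero]
      · refine dotProduct_eq_zero_iff.1 fun c => ?_
        rw [← dotProduct_mulVec, ← mulVec_mulVec, sub_mulVec, dotProduct_sub,
          dotProduct_mulVec _ R, hxR, zero_dotProduct, sub_zero]
        exact hJx _ (by rw [mulVec_mulVec, hS.mul_eq_zero, zero_mulVec]))
    refine ⟨0, 1, by simp, by simp, ?_, ?_, ?_⟩
    · rw [hA]
      exact hblocks.isRegularPencil fun _ => le_rfl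
    · rw [hA]
      -- The index is 0 when `r = 0` and 1 otherwise; the bound covers both.
      exact ⟨_, Finset.sup_le fun _ _ => le_rfl, r, _, hblocks, rfl⟩
    · rw [Matrix.mul_one]
      exact hsys.R_nonneg.add hBB
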